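/- Let $n\in\mathbb N$, let $A,B$ be complex positive semidefinite $n\times n$ matrices and let $\alpha\in[0,1]$. The $\alpha$-weighted geometric mean is defined by $$A\,\#_\alpha\,B:=A^{1/2}\bigl(A^{-1/2}BA^{-1/2}\bigr)^\alpha A^{1/2}$$ when $A$ and $B$ are invertible, and in general by $A\,\#_\alpha\,B:=\lim_{\varepsilon\searrow0}(A+\varepsilon I)\,\#_\alpha\,(B+\varepsilon I)$ (this limit exists, and it agrees with the formula when $A,B$ are invertible). For real numbers $a,b\ge0$ this reads $a\,\#_\alpha\,b=a^{1-\alpha}b^{\alpha}$ (with $0^0=1$). Let $\mu_1(X)\ge\dots\ge\mu_n(X)$ denote the singular values of an $n\times n$ matrix $X$ in decreasing order with multiplicities. Then, for every $k=1,\dots,n$, $$\Bigl\{\prod_{j=1}^k\mu_j(A)\Bigr\}\,\#_\alpha\,\Bigl\{\prod_{j=n+1-k}^n\mu_j(B)\Bigr\} \le\prod_{j=1}^k\mu_j(A\,\#_\alpha\,B) \le\Bigl\{\prod_{j=1}^k\mu_j(A)\Bigr\}\,\#_\alpha\,\Bigl\{\prod_{j=1}^k\mu_j(B)\Bigr\},$$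 $$\Bigl\{\prod_{j=n+1-k}^n\mu_j(A)\Bigr\}\,\#_\alpha\,\Bigl\{\prod_{j=1}^k\mu_j(B)\Bigr\} \ge\prod_{j=n+1-k}^n\mu_j(A\,\#_\alpha\,B) \ge\Bigl\{\prod_{j=n+1-k}^n\mu_j(A)\Bigr\}\,\#_\alpha\,\Bigl\{\prod_{j=n+1-k}^n\mu_j(B)\Bigr\}.$$ Moreover, $$A\,\#_\alpha\,B\prec_{(\log)}A^\downarrow\,\#_\alpha\,B^\downarrow,$$ where $X^\downarrow$ is the diagonal matrix of the eigenvalues $\lambda_1(X)\ge\dots\ge\lambda_n(X)$ of a Hermitian matrix $X$ in decreasing order, and, for positive semidefinite $X,Y$, the log-majorization $X\prec_{(\log)}Y$ means that $\prod_{j=1}^k\lambda_j(X)\le\prod_{j=1}^k\lambda_j(Y)$ for $k=1,\dots,n$, with equality for $k=n$. -/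

import Mathlib

open Filter Topology
open scoped ComplexOrder MatrixOrder

/-- The singular values of a complex `n × n` matrix in decreasing order with multiplicities,
indexed from `0`: `singVal X j` is `μ_{j+1}(X)` for `j < n`. -/
noncomputable def singVal {n : ℕ} (X : Matrix (Fin n) (Fin n) ℂ) (j : ℕ) : ℝ :=
  (Matrix.toLpLin 2 2 X).singularValues j

/-- The product `μ_1(X) ⋯ μ_k(X)` of the `k` largest singular values. -/
noncomputable def topProd {n : ℕ} (X : Matrix (Fin n) (Fin n) ℂ) (k : ℕ) : ℝ :=
  ∏ j ∈ Finset.range k, singVal X j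

/-- The product `μ_{n+1-k}(X) ⋯ μ_n(X)` of the `k` smallest singular values (for `k ≤ n`). -/
noncomputable def botProd {n : ℕ} (X : Matrix (Fin n) (Fin n) ℂ) (k : ℕ) : ℝ :=
  ∏ j ∈ Finset.Ico (n - k) n, singVal X j

/-- The formula `A^{1/2} (A^{-1/2} B A^{-1/2})^α A^{1/2}` defining the `α`-weighted geometric
mean of positive definite matrices; the powers are those of the continuous functional calculus. -/
noncomputable def posDefGeomMean {n : ℕ} (α : ℝ) (A B : Matrix (Fin n) (Fin n) ℂ) :
    Matrix (Fin n) (Fin n) ℂ :=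
  A ^ (1 / 2 : ℝ) * (A ^ (-1 / 2 : ℝ) * B * A ^ (-1 / 2 : ℝ)) ^ α * A ^ (1 / 2 : ℝ)

open Classical in
/-- The `α`-weighted geometric mean `A #_α B` of positive semidefinite matrices: the formula above
when both matrices are invertible, and otherwise the limit of
`(A + ε I) #_α (B + ε I)` as `ε ↘ 0`. -/
noncomputable def geomMean {n : ℕ} (α : ℝ) (A B : Matrix (Fin n) (Fin n) ℂ) :
    Matrix (Fin n) (Fin n) ℂ :=
  if A.PosDef ∧ B.PosDef then posDefGeomMean α A B
  else limUnder (𝓝[>] (0 : ℝ)) fun ε : ℝ => posDefGeomMean α (A + ε • 1) (B + ε • 1)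

/-- The scalar weighted geometric mean `a #_α b = a^{1-α} b^α` of `a, b ≥ 0`, `0 ≤ α ≤ 1`
(with `0^0 = 1`, so that `a #_0 b = a` and `a #_1 b = b`). -/
noncomputable def scalarGeomMean (α a b : ℝ) : ℝ :=
  a ^ (1 - α) * b ^ α

/-- The eigenvalues of a Hermitian matrix in decreasing order with multiplicities, indexed
from `0`. -/
noncomputable def eigDec {n : ℕ} {X : Matrix (Fin n) (Fin n) ℂ} (hX : X.IsHermitian)
    (i : Fin n) : ℝ :=
  hX.eigenvalues₀ (Fin.cast (Fintype.card_fin n).symm i)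

/-- The diagonal matrix `X^↓` of the eigenvalues of `X` in decreasing order. -/
noncomputable def diagDec {n : ℕ} {X : Matrix (Fin n) (Fin n) ℂ} (hX : X.IsHermitian) :
    Matrix (Fin n) (Fin n) ℂ :=
  Matrix.diagonal fun i => (eigDec hX i : ℂ)

/-- Log-majorization `X ≺_(log) Y` of positive semidefinite matrices: for every `k ≤ n` the product
of the `k` largest eigenvalues of `X` is at most that of `Y`, with equality for `k = n`. -/
def LogMajorized {n : ℕ} (X Y : Matrix (Fin n) (Fin n) ℂ) : Prop :=
  ∃ (hX : X.PosSemidef) (hY : Y.PosSemidef),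
    (∀ k : ℕ, 1 ≤ k → k ≤ n →
      ∏ i : Fin n with i.val < k, eigDec hX.isHermitian i ≤
        ∏ i : Fin n with i.val < k, eigDec hY.isHermitian i) ∧
    ∏ i : Fin n, eigDec hX.isHermitian i = ∏ i : Fin n, eigDec hY.isHermitian i

/-! For an isometry V : ℂᵏ → ℂⁿ put c_V(M) = det(V* M V), which is `compDet V M`. If M = S D S* with
D = diag(d), Cauchy–Binet gives c_V(M) = ∑ w_f ∏ d_{f(j)}, where the weights w_f ≥ 0 are normalized
squared minors of V*S and do not depend on d. When S is unitary they sum to 1. So on positive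
semidefinite M the products of the k largest and of the k smallest singular values are the maximum
and the minimum of c_V(M) over isometries V.

Positive definite A, B are simultaneously diagonalized by a congruence: A = SS*, B = S D S*, and
then A #_α B = S D^α S*. The three compressed determinants share the same weights, so Hölder gives
c_V(A #_α B) ≤ c_V(A) #_α c_V(B) (`compDet_posDefGeomMean_le`). Taking V optimal for the mean, or
for the bottom of A, yields both upper bounds. The lower bounds follow by dividing the identity
det(A #_α B) = det A #_α det B by the upper bounds for the complementary n - k singular values.

In the semidefinite case one lets ε ↘ 0. The limit exists because the mean is Loewner-monotone in
both arguments, and the bounds survive because a maximum or minimum over the compact set of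
isometries is continuous in M. The log-majorization is the upper bound for top products, since the
mean of the decreasing diagonals has exactly these products; at k = n the upper and lower bounds
coincide. -/

/-! ### Singular values and ordered eigenvalues -/

open Polynomial in
theorem sort_roots_prod_X_sub_C {n : ℕ} {d : Fin n → ℝ} (hd : Antitone d) :
    (((∏ i, (X - C (d i : ℂ))).roots).map RCLike.re).sort (· ≥ ·) = List.ofFn d := by
  rw [Polynomial.roots_prod _ _ (by
    simp [Finset.prod_ne_zero_iff, Polynomial.X_sub_C_ne_zero])]
  simp only [roots_X_sub_C, Multiset.bind_singleton, Multiset.map_map]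
  simp_rw [Fin.univ_val_map, Multiset.coe_sort]
  convert! List.mergeSort_of_pairwise ?_
  simp_rw [decide_eq_true_eq, ← List.sortedGE_iff_pairwise]
  exact hd.sortedGE_ofFn

-- The ordered eigenvalues of M*M are its sorted characteristic roots, so any decreasing list giving
-- the right characteristic polynomial must be the list of squared singular values.
open Polynomial in
theorem singVal_eq_sqrt_of_charpoly {n : ℕ} {M : Matrix (Fin n) (Fin n) ℂ}
    {d : Fin n → ℝ} (hd : Antitone d)
    (h : (M.conjTranspose * M).charpoly = ∏ i, (X - C (d i : ℂ))) (i : Fin n) :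
    singVal M i = √(d i) := by
  have hn : Module.finrank ℂ (EuclideanSpace ℂ (Fin n)) = n := by simp
  rw [singVal, LinearMap.singularValues_fin _ hn]
  have h1 :=
    (Matrix.toLpLin 2 2 M).isSymmetric_adjoint_comp_self.sort_roots_charpoly_eq_eigenvalues hn
  have h2 : (LinearMap.adjoint (Matrix.toLpLin 2 2 M) ∘ₗ (Matrix.toLpLin 2 2 M)).charpoly
      = (M.conjTranspose * M).charpoly := by
    rw [← Matrix.toEuclideanLin_conjTranspose_eq_adjoint, ← Matrix.toLpLin_mul]
    rw [Matrix.toLpLin_eq_toLin, ← LinearMap.charpoly_toMatrix _ (PiLp.basisFun 2 ℂ (Fin n)),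
      LinearMap.toMatrix_toLin]
  rw [h2, h, sort_roots_prod_X_sub_C hd] at h1
  rw [List.ofFn_injective h1]

theorem charpoly_unitary_conj_diagonal {n : ℕ} {U : Matrix (Fin n) (Fin n) ℂ}
    (hU : U.conjTranspose * U = 1) (d : Fin n → ℂ) :
    (U * Matrix.diagonal d * U.conjTranspose).charpoly =
      ∏ i, (Polynomial.X - Polynomial.C (d i)) := by
  rw [Matrix.charpoly_mul_comm, ← mul_assoc, hU, one_mul, Matrix.charpoly_diagonal]

theorem singVal_nonneg {n : ℕ} (M : Matrix (Fin n) (Fin n) ℂ) (j : ℕ) : 0 ≤ singVal M j :=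
  LinearMap.singularValues_nonneg _ j

theorem singVal_antitone {n : ℕ} (M : Matrix (Fin n) (Fin n) ℂ) : Antitone (singVal M) :=
  LinearMap.singularValues_antitone _

theorem exists_unitary_conj_eigDec {n : ℕ} {M : Matrix (Fin n) (Fin n) ℂ} (hM : M.IsHermitian) :
    ∃ U : Matrix (Fin n) (Fin n) ℂ, U.conjTranspose * U = 1 ∧ U * U.conjTranspose = 1 ∧
      M = U * Matrix.diagonal (fun i => (eigDec hM i : ℂ)) * U.conjTranspose := by
  -- `eigenvalues` lists the decreasing `eigenvalues₀` through an arbitrary equivalence; `e` undoes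
  -- it by permuting the eigenvector columns.
  let e : Fin n ≃ Fin n :=
    (Fintype.equivOfCardEq (Fintype.card_fin _) : Fin (Fintype.card (Fin n)) ≃ Fin n).symm.trans
      (finCongr (Fintype.card_fin n))
  have he : ∀ i, hM.eigenvalues i = eigDec hM (e i) := fun i => rfl
  have hs := hM.spectral_theorem
  rw [Unitary.conjStarAlgAut_apply] at hs
  set V : Matrix (Fin n) (Fin n) ℂ := (hM.eigenvectorUnitary : Matrix (Fin n) (Fin n) ℂ) with hV
  have hV1 : V.conjTranspose * V = 1 := Unitary.coe_star_mul_self hM.eigenvectorUnitary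
  have hV2 : V * V.conjTranspose = 1 := Unitary.coe_mul_star_self hM.eigenvectorUnitary
  have hD : (Matrix.diagonal fun i => (eigDec hM i : ℂ)) =
      (Matrix.diagonal (RCLike.ofReal ∘ hM.eigenvalues)).submatrix e.symm e.symm := by
    rw [Matrix.submatrix_diagonal_equiv]
    congr 1
    funext i
    simp [he]
  refine ⟨V.submatrix id e.symm, ?_, ?_, ?_⟩
  · rw [Matrix.conjTranspose_submatrix, ← Matrix.submatrix_mul _ _ _ id _ Function.bijective_id,
      hV1, Matrix.submatrix_one_equiv]
  · rw [Matrix.conjTranspose_submatrix, Matrix.submatrix_mul_equiv, hV2, Matrix.submatrix_id_id]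
  · rw [hD, Matrix.conjTranspose_submatrix, Matrix.submatrix_mul_equiv, Matrix.submatrix_mul_equiv,
      Matrix.submatrix_id_id]
    exact hs

theorem eigDec_antitone {n : ℕ} {M : Matrix (Fin n) (Fin n) ℂ} (hM : M.IsHermitian) :
    Antitone (eigDec hM) := fun _ _ h => hM.eigenvalues₀_antitone h

theorem eigDec_nonneg {n : ℕ} {M : Matrix (Fin n) (Fin n) ℂ} (hM : M.PosSemidef) (i : Fin n) :
    0 ≤ eigDec hM.isHermitian i := by
  have := hM.eigenvalues_nonneg ((Fintype.equivOfCardEq (Fintype.card_fin _) :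
    Fin (Fintype.card (Fin n)) ≃ Fin n) (Fin.cast (Fintype.card_fin n).symm i))
  simpa only [Matrix.IsHermitian.eigenvalues, Equiv.symm_apply_apply] using! this

theorem singVal_eq_of_unitary_conj {n : ℕ} {U : Matrix (Fin n) (Fin n) ℂ}
    (hU : U.conjTranspose * U = 1) {d : Fin n → ℝ} (hd : Antitone d) (hd0 : ∀ i, 0 ≤ d i)
    (i : Fin n) :
    singVal (U * Matrix.diagonal (fun i => (d i : ℂ)) * U.conjTranspose) i = d i := by
  have hd2 : Antitone fun i => d i ^ 2 := fun i j hij => pow_le_pow_left₀ (hd0 j) (hd hij) 2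
  rw [singVal_eq_sqrt_of_charpoly hd2, Real.sqrt_sq (hd0 i)]
  rw [← charpoly_unitary_conj_diagonal hU]
  congr 1
  have : (Matrix.diagonal fun i => ((d i ^ 2 : ℝ) : ℂ)) =
      Matrix.diagonal (fun i => (d i : ℂ)) * Matrix.diagonal (fun i => (d i : ℂ)) := by
    rw [Matrix.diagonal_mul_diagonal]
    simp [sq]
  rw [this]
  have h2 : (Matrix.diagonal fun i => (d i : ℂ)).conjTranspose =
      Matrix.diagonal fun i => (d i : ℂ) := by
    rw [Matrix.diagonal_conjTranspose]
    congr 1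
    funext i
    simp
  simp only [Matrix.conjTranspose_mul, Matrix.conjTranspose_conjTranspose, h2, Matrix.mul_assoc]
  rw [← Matrix.mul_assoc U.conjTranspose U, hU, Matrix.one_mul]

theorem singVal_eq_eigDec {n : ℕ} {M : Matrix (Fin n) (Fin n) ℂ} (hM : M.PosSemidef)
    (i : Fin n) : singVal M i = eigDec hM.isHermitian i := by
  obtain ⟨U, hU, -, h⟩ := exists_unitary_conj_eigDec hM.isHermitian
  have := singVal_eq_of_unitary_conj hU (eigDec_antitone hM.isHermitian) (eigDec_nonneg hM) i
  rwa [← h] at this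

theorem exists_unitary_conj_singVal {n : ℕ} {M : Matrix (Fin n) (Fin n) ℂ} (hM : M.PosSemidef) :
    ∃ U : Matrix (Fin n) (Fin n) ℂ, U.conjTranspose * U = 1 ∧ U * U.conjTranspose = 1 ∧
      M = U * Matrix.diagonal (fun i : Fin n => (singVal M i : ℂ)) * U.conjTranspose := by
  simp only [singVal_eq_eigDec hM]
  exact exists_unitary_conj_eigDec hM.isHermitian

/-! ### Cauchy–Binet and weighted sums of minors -/

open Equiv in
/-- The **Cauchy–Binet formula**, with the minors indexed by all maps instead of subsets. -/
theorem factorial_mul_det_mul {k n : ℕ} (M : Matrix (Fin k) (Fin n) ℂ)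
    (N : Matrix (Fin n) (Fin k) ℂ) :
    (k.factorial : ℂ) * (M * N).det =
      ∑ f : Fin k → Fin n, (M.submatrix id f).det * (N.submatrix f id).det := by
  have h1 : (M * N).det = ∑ f : Fin k → Fin n, (∏ j, M j (f j)) * (N.submatrix f id).det := by
    have h := (Matrix.detRowAlternating (R := ℂ) (n := Fin k)).toMultilinearMap.map_sum
      (fun (i : Fin k) (l : Fin n) => M i l • N l)
    have h' : (fun i => ∑ l, M i l • N l) = M * N := by
      funext i j
      simp [Matrix.mul_apply, Finset.sum_apply]
    rw [h'] at h
    refine h.trans (Finset.sum_congr rfl fun f _ => ?_)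
    exact (Matrix.detRowAlternating (R := ℂ) (n := Fin k)).toMultilinearMap.map_smul_univ _ _
  -- Replacing f by f ∘ σ costs a sign in the minor of N. Summing over all σ yields k! on the left
  -- and assembles the minor of M on the right.
  have h2 : ∀ σ : Perm (Fin k), (M * N).det =
      ∑ f : Fin k → Fin n, ((Perm.sign σ : ℤ) : ℂ) * (∏ j, M j (f (σ j))) *
        (N.submatrix f id).det := by
    intro σ
    rw [h1, ← (Equiv.arrowCongr σ⁻¹ (Equiv.refl (Fin n))).sum_comp]
    refine Finset.sum_congr rfl fun f _ => ?_
    have h3 : N.submatrix ((Equiv.arrowCongr σ⁻¹ (Equiv.refl (Fin n))) f) id =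
        (N.submatrix f id).submatrix σ id := by
      ext i j
      rfl
    rw [h3, Matrix.det_permute]
    simp only [Equiv.arrowCongr_apply, Function.comp_apply, Equiv.refl_apply]
    simp only [Perm.inv_def, Equiv.symm_symm]
    ring
  have h4 : (k.factorial : ℂ) * (M * N).det = ∑ σ : Perm (Fin k), (M * N).det := by
    simp [Fintype.card_perm]
  rw [h4, Finset.sum_congr rfl fun σ _ => h2 σ, Finset.sum_comm]
  refine Finset.sum_congr rfl fun f _ => ?_
  rw [← Finset.sum_mul, ← Matrix.det_transpose (M.submatrix id f), Matrix.det_apply' (M.submatrix id f).transpose]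
  rfl

/-- The normalized squared modulus of the minor of `W` with columns `f`. -/
noncomputable def minorWeight {k n : ℕ} (W : Matrix (Fin k) (Fin n) ℂ) (f : Fin k → Fin n) : ℝ :=
  ‖(W.submatrix id f).det‖ ^ 2 / k.factorial

theorem minorWeight_nonneg {k n : ℕ} (W : Matrix (Fin k) (Fin n) ℂ) (f : Fin k → Fin n) :
    0 ≤ minorWeight W f := by
  unfold minorWeight
  positivity

theorem minorWeight_eq_zero_of_not_injective {k n : ℕ} (W : Matrix (Fin k) (Fin n) ℂ)
    {f : Fin k → Fin n} (hf : ¬ Function.Injective f) : minorWeight W f = 0 := by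
  simp only [Function.Injective, not_forall] at hf
  obtain ⟨i, j, hij, hne⟩ := hf
  rw [minorWeight, Matrix.det_zero_of_column_eq hne (fun l => by simp [hij])]
  simp

/-- The minors of W* are the conjugates of those of W, so Cauchy–Binet produces squared moduli. The
k! in the weight compensates for counting each k-subset once per ordering. -/
theorem det_mul_diagonal_mul_conjTranspose {k n : ℕ} (W : Matrix (Fin k) (Fin n) ℂ)
    (d : Fin n → ℝ) :
    (W * Matrix.diagonal (fun i => (d i : ℂ)) * W.conjTranspose).det =
      ((∑ f, minorWeight W f * ∏ j, d (f j) : ℝ) : ℂ) := by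
  have hk : (k.factorial : ℂ) ≠ 0 := by exact_mod_cast k.factorial_ne_zero
  apply mul_left_cancel₀ hk
  rw [factorial_mul_det_mul]
  push_cast
  rw [Finset.mul_sum]
  refine Finset.sum_congr rfl fun f _ => ?_
  have h1 : ((W * Matrix.diagonal fun i => (d i : ℂ)).submatrix id f).det =
      (∏ j, (d (f j) : ℂ)) * (W.submatrix id f).det := by
    rw [← Matrix.det_mul_row]
    congr 1
    ext i j
    simp [Matrix.mul_diagonal, mul_comm]
  have h2 : (W.conjTranspose.submatrix f id).det = star (W.submatrix id f).det := by
    rw [← Matrix.det_conjTranspose, Matrix.conjTranspose_submatrix]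
  rw [h1, h2, minorWeight]
  push_cast
  rw [← Complex.mul_conj', starRingEnd_apply]
  field_simp

theorem le_apply_of_strictMono_fin {k : ℕ} {φ : Fin k → ℕ} (hφ : StrictMono φ) (j : Fin k) :
    (j : ℕ) ≤ φ j := by
  obtain ⟨m, hm⟩ := j
  induction m with
  | zero => exact Nat.zero_le _
  | succ m ih =>
    have h1 := ih (by omega)
    have h2 : φ ⟨m, by omega⟩ < φ ⟨m + 1, hm⟩ := hφ (by simp [Fin.lt_def])
    simp only at h1 ⊢
    omega

theorem apply_add_le_of_strictMono_fin {k n : ℕ} {φ : Fin k → ℕ} (hφ : StrictMono φ)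
    (hn : ∀ j, φ j < n) (j : Fin k) : φ j + k ≤ n + j := by
  obtain ⟨m, hm⟩ := j
  -- Induction on the distance t from the last index.
  obtain ⟨t, ht⟩ : ∃ t, m + t + 1 = k := ⟨k - m - 1, by omega⟩
  induction t generalizing m with
  | zero =>
    have := hn ⟨m, hm⟩
    simp only
    omega
  | succ t ih =>
    have h1 := ih (m + 1) (by omega) (by omega)
    have h2 : φ ⟨m, hm⟩ < φ ⟨m + 1, by omega⟩ := hφ (by simp [Fin.lt_def])
    simp only at h1 ⊢
    omega

/-- Sorting the image of f gives an increasing sequence, whose j-th term lies between j and n - k +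
j; a decreasing g can then be compared factor by factor. -/
theorem exists_strictMono_prod_eq (g : ℕ → ℝ) {k n : ℕ} {f : Fin k → Fin n}
    (hf : Function.Injective f) :
    ∃ φ : Fin k → ℕ, StrictMono φ ∧ (∀ j, φ j < n) ∧ ∏ j, g (f j) = ∏ j, g (φ j) := by
  have hc : (Finset.univ.image f).card = k := by
    rw [Finset.card_image_of_injective _ hf, Finset.card_fin]
  refine ⟨fun j => ((Finset.univ.image f).orderEmbOfFin hc j : Fin n),
    fun a b hab => ((Finset.univ.image f).orderEmbOfFin hc).strictMono hab, fun j => Fin.is_lt _, ?_⟩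
  have h1 : ∏ i ∈ Finset.univ.image f, g i = ∏ j, g (f j) := Finset.prod_image hf.injOn
  have h2 : ∏ i ∈ Finset.univ.image ((Finset.univ.image f).orderEmbOfFin hc), g i =
      ∏ j, g ((Finset.univ.image f).orderEmbOfFin hc j) :=
    Finset.prod_image ((Finset.univ.image f).orderEmbOfFin hc).injective.injOn
  rw [← h1, ← h2, Finset.image_orderEmbOfFin_univ]

theorem prod_apply_le_prod_range {g : ℕ → ℝ} (hg : Antitone g) (hg0 : ∀ i, 0 ≤ g i) {k n : ℕ}
    {f : Fin k → Fin n} (hf : Function.Injective f) :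
    ∏ j, g (f j) ≤ ∏ j ∈ Finset.range k, g j := by
  obtain ⟨φ, hφ, -, h⟩ := exists_strictMono_prod_eq g hf
  rw [h, Finset.prod_range]
  exact Finset.prod_le_prod (fun i _ => hg0 _) fun i _ => hg (le_apply_of_strictMono_fin hφ i)

theorem prod_Ico_le_prod_apply {g : ℕ → ℝ} (hg : Antitone g) (hg0 : ∀ i, 0 ≤ g i) {k n : ℕ}
    (hk : k ≤ n) {f : Fin k → Fin n} (hf : Function.Injective f) :
    ∏ j ∈ Finset.Ico (n - k) n, g j ≤ ∏ j, g (f j) := by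
  obtain ⟨φ, hφ, hφn, h⟩ := exists_strictMono_prod_eq g hf
  rw [h, Finset.prod_Ico_eq_prod_range, Nat.sub_sub_self hk, Finset.prod_range]
  refine Finset.prod_le_prod (fun i _ => hg0 _) fun i _ => hg ?_
  have := apply_add_le_of_strictMono_fin hφ hφn i
  omega

/-! ### Extremal characterization of products of singular values -/

/-- The determinant of the compression `Vᴴ M V` of `M`. -/
noncomputable def compDet {k n : ℕ} (V : Matrix (Fin n) (Fin k) ℂ)
    (M : Matrix (Fin n) (Fin n) ℂ) : ℝ :=
  (V.conjTranspose * M * V).det.re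

theorem compDet_conj_diagonal {k n m : ℕ} (V : Matrix (Fin n) (Fin k) ℂ)
    (S : Matrix (Fin n) (Fin m) ℂ) (d : Fin m → ℝ) :
    compDet V (S * Matrix.diagonal (fun i => (d i : ℂ)) * S.conjTranspose) =
      ∑ f, minorWeight (V.conjTranspose * S) f * ∏ j, d (f j) := by
  have h : V.conjTranspose * (S * Matrix.diagonal (fun i => (d i : ℂ)) * S.conjTranspose) * V =
      (V.conjTranspose * S) * Matrix.diagonal (fun i => (d i : ℂ)) *
        (V.conjTranspose * S).conjTranspose := by
    simp only [Matrix.conjTranspose_mul, Matrix.conjTranspose_conjTranspose, Matrix.mul_assoc]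
  rw [compDet, h, det_mul_diagonal_mul_conjTranspose, Complex.ofReal_re]

theorem compDet_self_conj {k n m : ℕ} (V : Matrix (Fin n) (Fin k) ℂ)
    (S : Matrix (Fin n) (Fin m) ℂ) :
    compDet V (S * S.conjTranspose) = ∑ f, minorWeight (V.conjTranspose * S) f := by
  have := compDet_conj_diagonal V S (fun _ => 1)
  simpa using this

theorem sum_minorWeight_of_isometry {k n : ℕ} {V : Matrix (Fin n) (Fin k) ℂ}
    (hV : V.conjTranspose * V = 1) {U : Matrix (Fin n) (Fin n) ℂ} (hU : U * U.conjTranspose = 1) :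
    ∑ f, minorWeight (V.conjTranspose * U) f = 1 := by
  rw [← compDet_self_conj, hU, compDet, Matrix.mul_one, hV, Matrix.det_one, Complex.one_re]

/-- The compressed determinant is a convex combination of products of k singular values. Terms with
a repeated index, which could break the bound in `botProd_le_compDet`, have weight zero. -/
theorem compDet_le_topProd {k n : ℕ} {V : Matrix (Fin n) (Fin k) ℂ}
    (hV : V.conjTranspose * V = 1) {M : Matrix (Fin n) (Fin n) ℂ} (hM : M.PosSemidef) :
    compDet V M ≤ topProd M k := by
  obtain ⟨U, -, hU, h⟩ := exists_unitary_conj_singVal hM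
  have h1 := compDet_conj_diagonal V U (fun i : Fin n => singVal M i)
  rw [← h] at h1
  rw [h1, ← one_mul (topProd M k), ← sum_minorWeight_of_isometry hV hU, Finset.sum_mul]
  refine Finset.sum_le_sum fun f _ => ?_
  by_cases hf : Function.Injective f
  · exact mul_le_mul_of_nonneg_left
      (prod_apply_le_prod_range (singVal_antitone M) (singVal_nonneg M) hf) (minorWeight_nonneg _ _)
  · simp [minorWeight_eq_zero_of_not_injective _ hf]

theorem botProd_le_compDet {k n : ℕ} (hk : k ≤ n) {V : Matrix (Fin n) (Fin k) ℂ}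
    (hV : V.conjTranspose * V = 1) {M : Matrix (Fin n) (Fin n) ℂ} (hM : M.PosSemidef) :
    botProd M k ≤ compDet V M := by
  obtain ⟨U, -, hU, h⟩ := exists_unitary_conj_singVal hM
  have h1 := compDet_conj_diagonal V U (fun i : Fin n => singVal M i)
  rw [← h] at h1
  rw [h1, ← one_mul (botProd M k), ← sum_minorWeight_of_isometry hV hU, Finset.sum_mul]
  refine Finset.sum_le_sum fun f _ => ?_
  by_cases hf : Function.Injective f
  · exact mul_le_mul_of_nonneg_left
      (prod_Ico_le_prod_apply (singVal_antitone M) (singVal_nonneg M) hk hf)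
      (minorWeight_nonneg _ _)
  · simp [minorWeight_eq_zero_of_not_injective _ hf]

/-- Take as V the eigenvectors selected by e; the compression is then diagonal. -/
theorem exists_isometry_compDet_eq {k n : ℕ} {M : Matrix (Fin n) (Fin n) ℂ} (hM : M.PosSemidef)
    {e : Fin k → Fin n} (he : Function.Injective e) :
    ∃ V : Matrix (Fin n) (Fin k) ℂ, V.conjTranspose * V = 1 ∧
      compDet V M = ∏ j, singVal M (e j) := by
  obtain ⟨U, hU, -, h⟩ := exists_unitary_conj_singVal hM
  refine ⟨U.submatrix id e, ?_, ?_⟩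
  · rw [Matrix.conjTranspose_submatrix, ← Matrix.submatrix_mul _ _ _ id _ Function.bijective_id,
      hU, Matrix.submatrix_one _ he]
  · have h1 : (U.submatrix id e).conjTranspose * M * U.submatrix id e =
        (U.conjTranspose * M * U).submatrix e e := by
      rw [Matrix.conjTranspose_submatrix,
        Matrix.submatrix_mul _ _ _ id _ Function.bijective_id,
        Matrix.submatrix_mul _ _ _ id _ Function.bijective_id, Matrix.submatrix_id_id]
    have h2 : U.conjTranspose * M * U = Matrix.diagonal fun i : Fin n => (singVal M i : ℂ) := by
      conv_lhs => rw [h]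
      simp only [Matrix.mul_assoc]
      rw [hU, Matrix.mul_one, ← Matrix.mul_assoc, hU, Matrix.one_mul]
    rw [compDet, h1, h2, Matrix.submatrix_diagonal _ _ he, Matrix.det_diagonal]
    simp only [Function.comp_apply]
    rw [← Complex.ofReal_prod, Complex.ofReal_re]

theorem exists_isometry_compDet_eq_topProd {k n : ℕ} (hk : k ≤ n) {M : Matrix (Fin n) (Fin n) ℂ}
    (hM : M.PosSemidef) :
    ∃ V : Matrix (Fin n) (Fin k) ℂ, V.conjTranspose * V = 1 ∧ compDet V M = topProd M k := by
  obtain ⟨V, hV, h⟩ := exists_isometry_compDet_eq hM (Fin.castLE_injective hk)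
  refine ⟨V, hV, ?_⟩
  rw [h, topProd, Finset.prod_range]
  rfl

theorem exists_isometry_compDet_eq_botProd {k n : ℕ} (hk : k ≤ n) {M : Matrix (Fin n) (Fin n) ℂ}
    (hM : M.PosSemidef) :
    ∃ V : Matrix (Fin n) (Fin k) ℂ, V.conjTranspose * V = 1 ∧ compDet V M = botProd M k := by
  obtain ⟨V, hV, h⟩ := exists_isometry_compDet_eq hM
    (e := fun j : Fin k => (⟨n - k + j, by omega⟩ : Fin n)) (fun i j hij => by
      simp only [Fin.mk.injEq] at hij
      exact Fin.ext (by omega))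
  refine ⟨V, hV, ?_⟩
  rw [h, botProd, Finset.prod_Ico_eq_prod_range, Nat.sub_sub_self hk, Finset.prod_range]

/-! ### Continuity of the products of singular values -/

/-- The isometries `V : ℂᵏ → ℂⁿ` form a compact set. -/
theorem isCompact_isometries (k n : ℕ) :
    IsCompact {V : Matrix (Fin n) (Fin k) ℂ | V.conjTranspose * V = 1} := by
  have hc : IsClosed {V : Matrix (Fin n) (Fin k) ℂ | V.conjTranspose * V = 1} :=
    isClosed_eq (by fun_prop) continuous_const
  refine IsCompact.of_isClosed_subset
    (isCompact_univ_pi fun _ : Fin n => isCompact_univ_pi fun _ : Fin k =>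
      isCompact_closedBall (0 : ℂ) 1) hc ?_
  intro V hV i _ j _
  have h1 : (V.conjTranspose * V) j j = 1 := by rw [hV]; simp
  rw [Matrix.mul_apply] at h1
  have h2 : ∑ l, ‖V l j‖ ^ 2 = 1 := by
    have : ((∑ l, ‖V l j‖ ^ 2 : ℝ) : ℂ) = 1 := by
      rw [← h1]
      push_cast
      refine Finset.sum_congr rfl fun l _ => ?_
      rw [← Complex.conj_mul']
      rfl
    exact_mod_cast this
  have h3 : ‖V i j‖ ^ 2 ≤ 1 := by
    rw [← h2]
    exact Finset.single_le_sum (f := fun l => ‖V l j‖ ^ 2) (fun _ _ => by positivity)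
      (Finset.mem_univ i)
  rw [mem_closedBall_zero_iff]
  exact (sq_le_one_iff₀ (norm_nonneg _)).1 h3

theorem continuous_compDet (k n : ℕ) :
    Continuous fun p : Matrix (Fin n) (Fin n) ℂ × Matrix (Fin n) (Fin k) ℂ =>
      compDet p.2 p.1 := by
  unfold compDet
  fun_prop

/-- On the positive semidefinite cone this is the maximum over a compact set of a jointly continuous
function. -/
theorem continuousOn_topProd {k n : ℕ} (hk : k ≤ n) :
    ContinuousOn (fun M : Matrix (Fin n) (Fin n) ℂ => topProd M k) {M | M.PosSemidef} := by
  have h := (isCompact_isometries k n).continuous_sSup (f := fun M V => compDet V M)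
    (continuous_compDet k n)
  refine h.continuousOn.congr fun M hM => ?_
  obtain ⟨V, hV, hVM⟩ := exists_isometry_compDet_eq_topProd hk hM
  have h1 : IsGreatest ((fun V => compDet V M) '' {V : Matrix (Fin n) (Fin k) ℂ |
      V.conjTranspose * V = 1}) (topProd M k) := by
    refine ⟨⟨V, hV, hVM⟩, ?_⟩
    rintro _ ⟨W, hW, rfl⟩
    exact compDet_le_topProd hW hM
  exact h1.csSup_eq.symm

theorem continuousOn_botProd {k n : ℕ} (hk : k ≤ n) :
    ContinuousOn (fun M : Matrix (Fin n) (Fin n) ℂ => botProd M k) {M | M.PosSemidef} := by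
  have h := (isCompact_isometries k n).continuous_sInf (f := fun M V => compDet V M)
    (continuous_compDet k n)
  refine h.continuousOn.congr fun M hM => ?_
  obtain ⟨V, hV, hVM⟩ := exists_isometry_compDet_eq_botProd hk hM
  have h1 : IsLeast ((fun V => compDet V M) '' {V : Matrix (Fin n) (Fin k) ℂ |
      V.conjTranspose * V = 1}) (botProd M k) := by
    refine ⟨⟨V, hV, hVM⟩, ?_⟩
    rintro _ ⟨W, hW, rfl⟩
    exact botProd_le_compDet hk hW hM
  exact h1.csInf_eq.symm

/-! ### Real powers and the geometric mean in diagonal coordinates -/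

theorem conj_diagonal_pow {n : ℕ} {U : Matrix (Fin n) (Fin n) ℂ}
    (hU : U.conjTranspose * U = 1) (hU' : U * U.conjTranspose = 1) (d : Fin n → ℂ) (m : ℕ) :
    (U * Matrix.diagonal d * U.conjTranspose) ^ m =
      U * Matrix.diagonal (fun i => d i ^ m) * U.conjTranspose := by
  induction m with
  | zero => simp [hU']
  | succ m ih =>
    have h : U * Matrix.diagonal (fun i => d i ^ m) * U.conjTranspose *
        (U * Matrix.diagonal d * U.conjTranspose) =
        U * (Matrix.diagonal (fun i => d i ^ m) * (U.conjTranspose * U) * Matrix.diagonal d) *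
          U.conjTranspose := by
      simp only [Matrix.mul_assoc]
    rw [pow_succ, ih, h, hU, Matrix.mul_one, Matrix.diagonal_mul_diagonal]
    simp only [pow_succ]

theorem aeval_conj_diagonal {n : ℕ} {U : Matrix (Fin n) (Fin n) ℂ}
    (hU : U.conjTranspose * U = 1) (hU' : U * U.conjTranspose = 1) (d : Fin n → ℝ)
    (q : Polynomial ℝ) :
    Polynomial.aeval (U * Matrix.diagonal (fun i => (d i : ℂ)) * U.conjTranspose) q =
      U * Matrix.diagonal (fun i => ((q.eval (d i) : ℝ) : ℂ)) * U.conjTranspose := by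
  induction q using Polynomial.induction_on' with
  | add p q hp hq =>
    rw [map_add, hp, hq, ← Matrix.add_mul, ← Matrix.mul_add, Matrix.diagonal_add]
    simp
  | monomial m r =>
    rw [Polynomial.aeval_monomial, conj_diagonal_pow hU hU', ← Algebra.smul_def]
    rw [← Matrix.smul_mul, ← Matrix.mul_smul]
    congr 2
    ext i j
    by_cases h : i = j <;> simp [Matrix.diagonal, h]

theorem spectrum_conj_diagonal_subset {n : ℕ} {U : Matrix (Fin n) (Fin n) ℂ}
    (hU' : U * U.conjTranspose = 1) (d : Fin n → ℝ) :
    spectrum ℝ (U * Matrix.diagonal (fun i => (d i : ℂ)) * U.conjTranspose) ⊆ Set.range d := by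
  intro r hr
  by_contra hd
  apply spectrum.mem_iff.1 hr
  have h1 : algebraMap ℝ (Matrix (Fin n) (Fin n) ℂ) r -
      U * Matrix.diagonal (fun i => (d i : ℂ)) * U.conjTranspose =
      U * Matrix.diagonal (fun i => ((r - d i : ℝ) : ℂ)) * U.conjTranspose := by
    have h2 : (Matrix.diagonal fun i => ((r - d i : ℝ) : ℂ)) =
        algebraMap ℝ (Matrix (Fin n) (Fin n) ℂ) r - Matrix.diagonal fun i => (d i : ℂ) := by
      rw [Matrix.algebraMap_eq_diagonal, Matrix.diagonal_sub]
      congr 1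
      funext i
      simp
    rw [h2, Matrix.mul_sub, Matrix.sub_mul, ← Algebra.commutes, Matrix.mul_assoc _ U, hU',
      Matrix.mul_one]
  have hdet : U.det * U.conjTranspose.det = 1 := by
    rw [← Matrix.det_mul, hU', Matrix.det_one]
  rw [h1, Matrix.isUnit_iff_isUnit_det, Matrix.det_mul, Matrix.det_mul, Matrix.det_diagonal,
    mul_right_comm, hdet, one_mul, isUnit_iff_ne_zero, Finset.prod_ne_zero_iff]
  intro i _ h
  exact hd ⟨i, by
    have : r - d i = 0 := by exact_mod_cast h
    linarith⟩

theorem posSemidef_conj_diagonal {n m : ℕ} (S : Matrix (Fin m) (Fin n) ℂ) {d : Fin n → ℝ}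
    (hd : ∀ i, 0 ≤ d i) :
    (S * Matrix.diagonal (fun i => (d i : ℂ)) * S.conjTranspose).PosSemidef :=
  (Matrix.PosSemidef.diagonal fun i => by simpa using hd i).mul_mul_conjTranspose_same S

theorem rpow_conj_diagonal {n : ℕ} {U : Matrix (Fin n) (Fin n) ℂ}
    (hU' : U * U.conjTranspose = 1) {d : Fin n → ℝ} (hd : ∀ i, 0 ≤ d i) (p : ℝ) :
    (U * Matrix.diagonal (fun i => (d i : ℂ)) * U.conjTranspose) ^ p =
      U * Matrix.diagonal (fun i => ((d i ^ p : ℝ) : ℂ)) * U.conjTranspose := by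
  have hU : U.conjTranspose * U = 1 := mul_eq_one_comm.1 hU'
  have hM := posSemidef_conj_diagonal U hd
  rw [CFC.rpow_eq_cfc_real hM.nonneg]
  -- A polynomial agreeing with x ^ p on the spectrum replaces the functional calculus. The nodes
  -- form the image of d, so repeated eigenvalues count once.
  set q : Polynomial ℝ := Lagrange.interpolate (Finset.univ.image d) id (fun x => x ^ p) with hq
  have hqd : ∀ i, q.eval (d i) = d i ^ p := fun i =>
    Lagrange.eval_interpolate_at_node (s := Finset.univ.image d) (v := id)
      (fun x : ℝ => x ^ p) Function.injective_id.injOn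
      (Finset.mem_image_of_mem d (Finset.mem_univ i))
  rw [cfc_congr (g := q.eval), cfc_polynomial q _ (show IsSelfAdjoint _ from hM.isHermitian), aeval_conj_diagonal hU hU']
  · simp only [hqd]
  · intro x hx
    obtain ⟨i, rfl⟩ := spectrum_conj_diagonal_subset hU' d hx
    exact (hqd i).symm

section HalfPowers

variable {n : ℕ} {A : Matrix (Fin n) (Fin n) ℂ}

theorem rpow_half_mul_self (hA : A.PosSemidef) : A ^ (1 / 2 : ℝ) * A ^ (1 / 2 : ℝ) = A := by
  rw [← CFC.sqrt_eq_rpow]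
  exact CFC.sqrt_mul_sqrt_self A hA.nonneg

theorem rpow_half_mul_rpow_neg_half (hA : A.PosDef) :
    A ^ (1 / 2 : ℝ) * A ^ (-1 / 2 : ℝ) = 1 := by
  rw [neg_div]
  exact CFC.rpow_mul_rpow_neg _ hA.isStrictlyPositive

theorem conjTranspose_rpow (A : Matrix (Fin n) (Fin n) ℂ) (p : ℝ) :
    (A ^ p).conjTranspose = A ^ p :=
  (Matrix.nonneg_iff_posSemidef.1 (CFC.rpow_nonneg (a := A) (y := p))).isHermitian

end HalfPowers

/-- By polar decomposition A^{-1/2} S is unitary when A = SS*, so it diagonalizes A^{-1/2} B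
A^{-1/2}, and the outer factors A^{1/2} restore S. -/
theorem posDefGeomMean_conj_diagonal {n : ℕ} (α : ℝ) {S : Matrix (Fin n) (Fin n) ℂ}
    (hS : IsUnit S) {d : Fin n → ℝ} (hd : ∀ i, 0 ≤ d i) :
    posDefGeomMean α (S * S.conjTranspose)
        (S * Matrix.diagonal (fun i => (d i : ℂ)) * S.conjTranspose) =
      S * Matrix.diagonal (fun i => ((d i ^ α : ℝ) : ℂ)) * S.conjTranspose := by
  have hA : (S * S.conjTranspose).PosDef := by
    rw [(Matrix.posSemidef_self_mul_conjTranspose S).posDef_iff_isUnit]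
    exact hS.mul hS.star
  set A := S * S.conjTranspose with hAdef
  set R := A ^ (1 / 2 : ℝ) with hR
  set R' := A ^ (-1 / 2 : ℝ) with hR'
  have hRR : R * R = A := rpow_half_mul_self hA.posSemidef
  have hRR' : R * R' = 1 := rpow_half_mul_rpow_neg_half hA
  have hR'R : R' * R = 1 := mul_eq_one_comm.1 hRR'
  have hRs : R.conjTranspose = R := conjTranspose_rpow A _
  have hR's : R'.conjTranspose = R' := conjTranspose_rpow A _
  have hU : (R' * S) * (R' * S).conjTranspose = 1 := by
    rw [Matrix.conjTranspose_mul, hR's]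
    calc R' * S * (S.conjTranspose * R') = R' * (S * S.conjTranspose) * R' := by
          simp only [Matrix.mul_assoc]
      _ = (R' * R) * (R * R') := by rw [← hAdef, ← hRR]; simp only [Matrix.mul_assoc]
      _ = 1 := by rw [hRR', hR'R, Matrix.one_mul]
  have hC : R' * (S * Matrix.diagonal (fun i => (d i : ℂ)) * S.conjTranspose) * R' =
      (R' * S) * Matrix.diagonal (fun i => (d i : ℂ)) * (R' * S).conjTranspose := by
    rw [Matrix.conjTranspose_mul, hR's]
    simp only [Matrix.mul_assoc]
  rw [posDefGeomMean, ← hR, ← hR', hC, rpow_conj_diagonal hU hd, Matrix.conjTranspose_mul, hR's]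
  calc _ = (R * R') * (S * Matrix.diagonal (fun i => ((d i ^ α : ℝ) : ℂ)) * S.conjTranspose) *
        (R' * R) := by simp only [Matrix.mul_assoc]
    _ = _ := by rw [hRR', hR'R, Matrix.one_mul, Matrix.mul_one]

theorem eigDec_pos {n : ℕ} {M : Matrix (Fin n) (Fin n) ℂ} (hM : M.PosDef) (i : Fin n) :
    0 < eigDec hM.isHermitian i := by
  have := hM.eigenvalues_pos ((Fintype.equivOfCardEq (Fintype.card_fin _) :
    Fin (Fintype.card (Fin n)) ≃ Fin n) (Fin.cast (Fintype.card_fin n).symm i))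
  simpa only [Matrix.IsHermitian.eigenvalues, Equiv.symm_apply_apply] using! this

/-- Two positive definite matrices are simultaneously diagonalizable by a congruence. -/
theorem exists_congruence_diagonal {n : ℕ} {A B : Matrix (Fin n) (Fin n) ℂ} (hA : A.PosDef)
    (hB : B.PosDef) :
    ∃ (S : Matrix (Fin n) (Fin n) ℂ) (d : Fin n → ℝ), IsUnit S ∧ (∀ i, 0 < d i) ∧
      A = S * S.conjTranspose ∧
      B = S * Matrix.diagonal (fun i => (d i : ℂ)) * S.conjTranspose := by
  set R := A ^ (1 / 2 : ℝ) with hR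
  set R' := A ^ (-1 / 2 : ℝ) with hR'
  have hRR : R * R = A := rpow_half_mul_self hA.posSemidef
  have hRR' : R * R' = 1 := rpow_half_mul_rpow_neg_half hA
  have hR'R : R' * R = 1 := mul_eq_one_comm.1 hRR'
  have hRs : R.conjTranspose = R := conjTranspose_rpow A _
  have hR's : R'.conjTranspose = R' := conjTranspose_rpow A _
  have hRu : IsUnit R := IsUnit.of_mul_eq_one _ hRR'
  have hR'u : IsUnit R' := IsUnit.of_mul_eq_one _ hR'R
  have hC : (R' * B * R').PosDef := by
    have h := hB.posSemidef.mul_mul_conjTranspose_same R'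
    rw [hR's] at h
    rw [h.posDef_iff_isUnit]
    exact (hR'u.mul hB.isUnit).mul hR'u
  obtain ⟨U, hU, hU', h⟩ := exists_unitary_conj_eigDec hC.isHermitian
  refine ⟨R * U, eigDec hC.isHermitian, hRu.mul (IsUnit.of_mul_eq_one _ hU'), eigDec_pos hC, ?_, ?_⟩
  · rw [Matrix.conjTranspose_mul, hRs, Matrix.mul_assoc, ← Matrix.mul_assoc U, hU', Matrix.one_mul,
      hRR]
  · rw [Matrix.conjTranspose_mul, hRs]
    calc B = (R * R') * B * (R' * R) := by rw [hRR', hR'R, Matrix.one_mul, Matrix.mul_one]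
      _ = R * (R' * B * R') * R := by simp only [Matrix.mul_assoc]
      _ = _ := by conv_lhs => rw [h]
                  simp only [Matrix.mul_assoc]

theorem posDefGeomMean_posDef {n : ℕ} (α : ℝ) {A B : Matrix (Fin n) (Fin n) ℂ} (hA : A.PosDef)
    (hB : B.PosDef) : (posDefGeomMean α A B).PosDef := by
  obtain ⟨S, d, hS, hd, rfl, rfl⟩ := exists_congruence_diagonal hA hB
  rw [posDefGeomMean_conj_diagonal α hS fun i => (hd i).le]
  rw [(posSemidef_conj_diagonal S fun i => Real.rpow_nonneg (hd i).le α).posDef_iff_isUnit]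
  refine (hS.mul ?_).mul hS.star
  rw [Matrix.isUnit_diagonal, Pi.isUnit_iff]
  intro i
  rw [isUnit_iff_ne_zero]
  exact_mod_cast (Real.rpow_pos_of_pos (hd i) α).ne'

/-- With T = S D^{1/2} one has B = TT* and A = T D⁻¹ T*, and d · d^{-(1-α)} = d^α. -/
theorem posDefGeomMean_comm {n : ℕ} (α : ℝ) {A B : Matrix (Fin n) (Fin n) ℂ} (hA : A.PosDef)
    (hB : B.PosDef) : posDefGeomMean α A B = posDefGeomMean (1 - α) B A := by
  obtain ⟨S, d, hS, hd, rfl, rfl⟩ := exists_congruence_diagonal hA hB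
  rw [posDefGeomMean_conj_diagonal α hS fun i => (hd i).le]
  have hsd : ∀ i, 0 < √(d i) := fun i => Real.sqrt_pos.2 (hd i)
  set D : Matrix (Fin n) (Fin n) ℂ := Matrix.diagonal fun i => ((√(d i) : ℝ) : ℂ) with hD
  have hDs : D.conjTranspose = D := by
    rw [hD, Matrix.diagonal_conjTranspose]
    congr 1
    funext i
    simp
  have hT : IsUnit (S * D) := by
    refine hS.mul ?_
    rw [hD, Matrix.isUnit_diagonal, Pi.isUnit_iff]
    intro i
    rw [isUnit_iff_ne_zero]
    exact_mod_cast (hsd i).ne'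
  have key : ∀ e : Fin n → ℝ, S * D * Matrix.diagonal (fun i => (e i : ℂ)) *
      (S * D).conjTranspose = S * Matrix.diagonal (fun i => ((d i * e i : ℝ) : ℂ)) *
        S.conjTranspose := by
    intro e
    have h1 : D * Matrix.diagonal (fun i => (e i : ℂ)) * D =
        Matrix.diagonal (fun i => ((d i * e i : ℝ) : ℂ)) := by
      rw [hD, Matrix.diagonal_mul_diagonal, Matrix.diagonal_mul_diagonal]
      congr 1
      funext i
      rw [← Complex.ofReal_mul, ← Complex.ofReal_mul, mul_right_comm, Real.mul_self_sqrt (hd i).le]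
    rw [← h1, Matrix.conjTranspose_mul, hDs]
    simp only [Matrix.mul_assoc]
  have hB' : S * Matrix.diagonal (fun i => (d i : ℂ)) * S.conjTranspose =
      S * D * (S * D).conjTranspose := by
    have := key fun _ => 1
    simp only [mul_one, Complex.ofReal_one, Matrix.diagonal_one] at this
    exact this.symm
  have hA' : S * S.conjTranspose =
      S * D * Matrix.diagonal (fun i => ((d i)⁻¹ : ℝ) : Fin n → ℂ) * (S * D).conjTranspose := by
    rw [key]
    simp [mul_inv_cancel₀ (hd _).ne']
  rw [hB', hA', posDefGeomMean_conj_diagonal (1 - α) hT fun i => (inv_pos.2 (hd i)).le, key]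
  congr 3
  funext i
  rw [Real.inv_rpow (hd i).le, ← Real.rpow_neg (hd i).le]
  nth_rewrite 2 [← Real.rpow_one (d i)]
  rw [← Real.rpow_add (hd i)]
  congr 2
  ring

theorem posDefGeomMean_smul {n : ℕ} (α : ℝ) {A B : Matrix (Fin n) (Fin n) ℂ} (hA : A.PosDef)
    (hB : B.PosDef) {t : ℝ} (ht : 0 < t) :
    posDefGeomMean α (t • A) (t • B) = t • posDefGeomMean α A B := by
  obtain ⟨S, d, hS, hd, rfl, rfl⟩ := exists_congruence_diagonal hA hB
  rw [posDefGeomMean_conj_diagonal α hS fun i => (hd i).le]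
  have hu : IsUnit (√t • S) := hS.smul (Units.mk0 _ (Real.sqrt_pos.2 ht).ne')
  have key : ∀ X : Matrix (Fin n) (Fin n) ℂ, √t • S * X * (√t • S).conjTranspose =
      t • (S * X * S.conjTranspose) := by
    intro X
    rw [Matrix.conjTranspose_smul, Matrix.smul_mul, Matrix.smul_mul, Matrix.mul_smul, smul_smul]
    simp [Real.mul_self_sqrt ht.le]
  have h1 := key 1
  rw [Matrix.mul_one, Matrix.mul_one] at h1
  rw [← h1, ← key, posDefGeomMean_conj_diagonal α hu fun i => (hd i).le, key]

/-! ### Loewner monotonicity -/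

section Monotone

open scoped Matrix.Norms.L2Operator

/-- The Löwner–Heinz inequality; the operator norm supplies the C⋆-algebra structure. -/
theorem rpow_le_rpow_of_le {n : ℕ} {α : ℝ} (hα0 : 0 ≤ α) (hα1 : α ≤ 1)
    {A B : Matrix (Fin n) (Fin n) ℂ} (h : A ≤ B) : A ^ α ≤ B ^ α :=
  CFC.rpow_le_rpow ⟨hα0, hα1⟩ h

theorem isClosed_posSemidef (n : ℕ) : IsClosed {M : Matrix (Fin n) (Fin n) ℂ | M.PosSemidef} := by
  have h : IsClosed {M : Matrix (Fin n) (Fin n) ℂ | 0 ≤ M} := CStarAlgebra.isClosed_nonneg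
  simpa only [Matrix.nonneg_iff_posSemidef] using h

end Monotone

theorem mul_mul_conjTranspose_mono {n m : ℕ} {M N : Matrix (Fin n) (Fin n) ℂ} (h : M ≤ N)
    (S : Matrix (Fin m) (Fin n) ℂ) : S * M * S.conjTranspose ≤ S * N * S.conjTranspose := by
  rw [Matrix.le_iff, ← Matrix.sub_mul, ← Matrix.mul_sub]
  exact (Matrix.le_iff.1 h).mul_mul_conjTranspose_same S

theorem posDefGeomMean_mono_right {n : ℕ} {α : ℝ} (hα0 : 0 ≤ α) (hα1 : α ≤ 1)
    (A : Matrix (Fin n) (Fin n) ℂ) {B B' : Matrix (Fin n) (Fin n) ℂ} (h : B ≤ B') :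
    posDefGeomMean α A B ≤ posDefGeomMean α A B' := by
  have h1 := mul_mul_conjTranspose_mono h (A ^ (-1 / 2 : ℝ))
  rw [conjTranspose_rpow] at h1
  have h2 := mul_mul_conjTranspose_mono (rpow_le_rpow_of_le hα0 hα1 h1) (A ^ (1 / 2 : ℝ))
  rwa [conjTranspose_rpow] at h2

/-- Monotonicity on the right is Löwner–Heinz; the symmetry exchanging α and 1 - α carries it to the
left argument. -/
theorem posDefGeomMean_mono {n : ℕ} {α : ℝ} (hα0 : 0 ≤ α) (hα1 : α ≤ 1)
    {A A' B B' : Matrix (Fin n) (Fin n) ℂ} (hA : A.PosDef) (hA' : A'.PosDef)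
    (hB' : B'.PosDef) (hAA' : A ≤ A') (hBB' : B ≤ B') :
    posDefGeomMean α A B ≤ posDefGeomMean α A' B' := by
  calc posDefGeomMean α A B ≤ posDefGeomMean α A B' := posDefGeomMean_mono_right hα0 hα1 A hBB'
    _ = posDefGeomMean (1 - α) B' A := posDefGeomMean_comm α hA hB'
    _ ≤ posDefGeomMean (1 - α) B' A' :=
      posDefGeomMean_mono_right (by linarith) (by linarith) B' hAA'
    _ = posDefGeomMean α A' B' := (posDefGeomMean_comm α hA' hB').symm

theorem posDef_add_smul_one {n : ℕ} {A : Matrix (Fin n) (Fin n) ℂ} (hA : A.PosSemidef) {ε : ℝ}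
    (hε : 0 < ε) : (A + ε • (1 : Matrix (Fin n) (Fin n) ℂ)).PosDef :=
  Matrix.PosDef.posSemidef_add hA (Matrix.PosDef.one.smul hε)

theorem add_smul_one_mono {n : ℕ} (A : Matrix (Fin n) (Fin n) ℂ) {ε δ : ℝ} (h : ε ≤ δ) :
    A + ε • (1 : Matrix (Fin n) (Fin n) ℂ) ≤ A + δ • (1 : Matrix (Fin n) (Fin n) ℂ) := by
  rw [Matrix.le_iff, add_sub_add_left_eq_sub, ← sub_smul]
  exact Matrix.PosSemidef.one.smul (sub_nonneg.2 h)

theorem tendsto_add_smul_one {n : ℕ} (A : Matrix (Fin n) (Fin n) ℂ) :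
    Tendsto (fun ε : ℝ => A + ε • (1 : Matrix (Fin n) (Fin n) ℂ)) (𝓝[>] 0) (𝓝 A) := by
  have h : Continuous fun ε : ℝ => A + ε • (1 : Matrix (Fin n) (Fin n) ℂ) := by fun_prop
  have := h.tendsto 0
  simp only [zero_smul, add_zero] at this
  exact this.mono_left nhdsWithin_le_nhds

/-! ### Existence of the limit and consistency with the formula -/

theorem polarization_entry {n : ℕ} (M : Matrix (Fin n) (Fin n) ℂ) (i j : Fin n) :
    let q := fun x : Fin n → ℂ => star x ⬝ᵥ M.mulVec x
    let x := Pi.single (M := fun _ => ℂ) i 1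
    let y := Pi.single (M := fun _ => ℂ) j 1
    M i j = (1 / 2) * ((q (x + y) - q x - q y) -
      Complex.I * (q (x + Complex.I • y) - q x - q y)) := by
  intro q x y
  have hxy : star x ⬝ᵥ M.mulVec y = M i j := by simp [x, y]
  have h1 : q (x + y) = q x + q y + star x ⬝ᵥ M.mulVec y + star y ⬝ᵥ M.mulVec x := by
    simp only [q, star_add, Matrix.mulVec_add, dotProduct_add, add_dotProduct]
    ring
  have h2 : q (x + Complex.I • y) = q x + q y + Complex.I * (star x ⬝ᵥ M.mulVec y) -
      Complex.I * (star y ⬝ᵥ M.mulVec x) := by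
    simp only [q, star_add, star_smul, Matrix.mulVec_add, Matrix.mulVec_smul, dotProduct_add,
      add_dotProduct, smul_dotProduct, dotProduct_smul, smul_eq_mul, Complex.star_def,
      Complex.conj_I]
    linear_combination (-(star y ⬝ᵥ M.mulVec y)) * Complex.I_mul_I
  rw [h1, h2, ← hxy]
  linear_combination (star x ⬝ᵥ M.mulVec y - star y ⬝ᵥ M.mulVec x) / 2 * Complex.I_mul_I

/-- A Loewner-monotone family of positive semidefinite matrices converges from the right. -/
theorem exists_tendsto_of_monotoneOn {n : ℕ} {G : ℝ → Matrix (Fin n) (Fin n) ℂ}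
    (hG : ∀ ε, 0 < ε → (G ε).PosSemidef) (hmono : ∀ ε δ, 0 < ε → ε ≤ δ → G ε ≤ G δ) :
    ∃ L, Tendsto G (𝓝[>] 0) (𝓝 L) := by
  have hq : ∀ x : Fin n → ℂ, ∃ l, Tendsto (fun ε => star x ⬝ᵥ (G ε).mulVec x) (𝓝[>] 0) (𝓝 l) := by
    intro x
    -- Each quadratic form is real, monotone in ε and bounded below by 0, hence converges;
    -- polarization then gives convergence of the entries.
    have h1 : MonotoneOn (fun ε => (star x ⬝ᵥ (G ε).mulVec x).re) (Set.Ioi 0) := by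
      intro ε hε δ _ hεδ
      have h2 := (Matrix.le_iff.1 (hmono ε δ hε hεδ)).dotProduct_mulVec_nonneg x
      rw [Matrix.sub_mulVec, dotProduct_sub, sub_nonneg] at h2
      exact (Complex.le_def.1 h2).1
    have h3 : BddBelow ((fun ε => (star x ⬝ᵥ (G ε).mulVec x).re) '' Set.Ioi 0) := by
      refine ⟨0, ?_⟩
      rintro _ ⟨ε, hε, rfl⟩
      exact (Complex.le_def.1 ((hG ε hε).dotProduct_mulVec_nonneg x)).1
    refine ⟨_, ((Complex.continuous_ofReal.tendsto _).comp (h1.tendsto_nhdsGT h3)).congr' ?_⟩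
    filter_upwards [self_mem_nhdsWithin] with ε hε
    apply Complex.ext
    · simp
    · simpa using (Complex.le_def.1 ((hG ε hε).dotProduct_mulVec_nonneg x)).2
  choose l hl using hq
  have hentry : ∀ i j, ∃ c, Tendsto (fun ε => G ε i j) (𝓝[>] 0) (𝓝 c) := fun i j =>
    ⟨_, Tendsto.congr (fun ε => (polarization_entry (G ε) i j).symm)
      ((((hl _).sub (hl _)).sub (hl _) |>.sub
        ((((hl _).sub (hl _)).sub (hl _)).const_mul _)).const_mul _)⟩
  choose c hc using hentry
  exact ⟨Matrix.of c, tendsto_pi_nhds.2 fun i => tendsto_pi_nhds.2 fun j => hc i j⟩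

theorem exists_smul_one_le {n : ℕ} {A : Matrix (Fin n) (Fin n) ℂ} (hA : A.PosDef) :
    ∃ m : ℝ, 0 < m ∧ m • (1 : Matrix (Fin n) (Fin n) ℂ) ≤ A := by
  obtain ⟨U, -, hU, h⟩ := exists_unitary_conj_eigDec hA.isHermitian
  obtain ⟨m, hm, hmd⟩ : ∃ m : ℝ, 0 < m ∧ ∀ i, m ≤ eigDec hA.isHermitian i := by
    rcases isEmpty_or_nonempty (Fin n) with _ | _
    · exact ⟨1, one_pos, fun i => isEmptyElim i⟩
    · obtain ⟨i, hi⟩ := Finite.exists_min (eigDec hA.isHermitian)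
      exact ⟨_, eigDec_pos hA i, hi⟩
  refine ⟨m, hm, ?_⟩
  have h1 := posSemidef_conj_diagonal U (d := fun i => eigDec hA.isHermitian i - m)
    fun i => sub_nonneg.2 (hmd i)
  have h2 : (Matrix.diagonal fun i => ((eigDec hA.isHermitian i - m : ℝ) : ℂ)) =
      (Matrix.diagonal fun i => (eigDec hA.isHermitian i : ℂ)) -
        m • (1 : Matrix (Fin n) (Fin n) ℂ) := by
    ext i j
    by_cases hij : i = j <;> simp [Matrix.diagonal, hij]
  rw [h2, Matrix.mul_sub, Matrix.sub_mul, ← h, Matrix.mul_smul, Matrix.mul_one, Matrix.smul_mul,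
    hU] at h1
  exact Matrix.le_iff.2 h1

/-- If m I ≤ A then ε I ≤ (ε / m) A. Every larger c' is allowed too, so that A and B can share one
constant. -/
theorem exists_add_smul_one_le {n : ℕ} {A : Matrix (Fin n) (Fin n) ℂ} (hA : A.PosDef) :
    ∃ c : ℝ, 0 < c ∧ ∀ ε : ℝ, 0 ≤ ε → ∀ c' ≥ c,
      A + ε • (1 : Matrix (Fin n) (Fin n) ℂ) ≤ (1 + c' * ε) • A := by
  obtain ⟨m, hm, h⟩ := exists_smul_one_le hA
  refine ⟨m⁻¹, inv_pos.2 hm, fun ε hε c' hc' => ?_⟩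
  have h0 : (A - m • (1 : Matrix (Fin n) (Fin n) ℂ)).PosSemidef := Matrix.le_iff.1 h
  have h1 := (h0.smul (mul_nonneg (inv_pos.2 hm).le hε)).add
    (hA.posSemidef.smul (mul_nonneg (sub_nonneg.2 hc') hε))
  rw [Matrix.le_iff]
  convert! h1 using 1
  rw [smul_sub, smul_smul, mul_right_comm, inv_mul_cancel₀ hm.ne', one_mul]
  module

/-- Monotonicity and homogeneity squeeze the perturbed mean between G and (1 + cε) G, and the
positive semidefinite cone is closed. -/
theorem tendsto_posDefGeomMean_of_posDef {n : ℕ} {α : ℝ} (hα0 : 0 ≤ α) (hα1 : α ≤ 1)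
    {A B : Matrix (Fin n) (Fin n) ℂ} (hA : A.PosDef) (hB : B.PosDef)
    {L : Matrix (Fin n) (Fin n) ℂ}
    (hL : Tendsto (fun ε : ℝ => posDefGeomMean α (A + ε • 1) (B + ε • 1)) (𝓝[>] 0) (𝓝 L)) :
    L = posDefGeomMean α A B := by
  set G := posDefGeomMean α A B with hG
  have hcl := isClosed_posSemidef n
  apply le_antisymm
  · obtain ⟨a, ha, hAa⟩ := exists_add_smul_one_le hA
    obtain ⟨b, hb, hBb⟩ := exists_add_smul_one_le hB
    have h1 : Tendsto (fun ε : ℝ => (1 + max a b * ε) • G) (𝓝[>] 0) (𝓝 G) := by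
      have h : Continuous fun ε : ℝ => (1 + max a b * ε) • G := by fun_prop
      have := h.tendsto 0
      simp only [mul_zero, add_zero, one_smul] at this
      exact this.mono_left nhdsWithin_le_nhds
    rw [Matrix.le_iff]
    refine hcl.mem_of_tendsto (h1.sub hL) ?_
    filter_upwards [self_mem_nhdsWithin] with ε hε
    have hε' : (0 : ℝ) < ε := hε
    have hc : 0 < 1 + max a b * ε := by positivity
    refine Matrix.le_iff.1 ?_
    rw [hG, ← posDefGeomMean_smul α hA hB hc]
    exact posDefGeomMean_mono hα0 hα1 (posDef_add_smul_one hA.posSemidef hε) (hA.smul hc)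
      (hB.smul hc) (hAa ε hε'.le _ (le_max_left _ _))
      (hBb ε hε'.le _ (le_max_right _ _))
  · rw [Matrix.le_iff]
    refine hcl.mem_of_tendsto (hL.sub_const G) ?_
    filter_upwards [self_mem_nhdsWithin] with ε hε
    have hε' : (0 : ℝ) < ε := hε
    have hle : ∀ M : Matrix (Fin n) (Fin n) ℂ, M ≤ M + ε • (1 : Matrix (Fin n) (Fin n) ℂ) := by
      intro M
      simpa using add_smul_one_mono M hε'.le
    exact Matrix.le_iff.1 (posDefGeomMean_mono hα0 hα1 hA (posDef_add_smul_one hA.posSemidef hε)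
      (posDef_add_smul_one hB.posSemidef hε) (hle A) (hle B))

theorem tendsto_geomMean {n : ℕ} {α : ℝ} (hα0 : 0 ≤ α) (hα1 : α ≤ 1)
    {A B : Matrix (Fin n) (Fin n) ℂ} (hA : A.PosSemidef) (hB : B.PosSemidef) :
    Tendsto (fun ε : ℝ => posDefGeomMean α (A + ε • 1) (B + ε • 1)) (𝓝[>] 0)
      (𝓝 (geomMean α A B)) := by
  obtain ⟨L, hL⟩ := exists_tendsto_of_monotoneOn
    (G := fun ε : ℝ => posDefGeomMean α (A + ε • 1) (B + ε • 1))
    (fun ε hε => (posDefGeomMean_posDef α (posDef_add_smul_one hA hε)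
      (posDef_add_smul_one hB hε)).posSemidef)
    (fun ε δ hε hεδ => posDefGeomMean_mono hα0 hα1 (posDef_add_smul_one hA hε)
      (posDef_add_smul_one hA (hε.trans_le hεδ))
      (posDef_add_smul_one hB (hε.trans_le hεδ)) (add_smul_one_mono A hεδ)
      (add_smul_one_mono B hεδ))
  rw [geomMean]
  split_ifs with h
  · rwa [← tendsto_posDefGeomMean_of_posDef hα0 hα1 h.1 h.2 hL]
  · rwa [hL.limUnder_eq]

theorem posSemidef_geomMean {n : ℕ} {α : ℝ} (hα0 : 0 ≤ α) (hα1 : α ≤ 1)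
    {A B : Matrix (Fin n) (Fin n) ℂ} (hA : A.PosSemidef) (hB : B.PosSemidef) :
    (geomMean α A B).PosSemidef := by
  refine (isClosed_posSemidef n).mem_of_tendsto (tendsto_geomMean hα0 hα1 hA hB) ?_
  filter_upwards [self_mem_nhdsWithin] with ε hε
  exact (posDefGeomMean_posDef α (posDef_add_smul_one hA hε) (posDef_add_smul_one hB hε)).posSemidef

/-! ### Diagonal matrices and scalar means -/

theorem posDefGeomMean_diagonal {n : ℕ} (α : ℝ) {a b : Fin n → ℝ} (ha : ∀ i, 0 < a i)
    (hb : ∀ i, 0 < b i) :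
    posDefGeomMean α (Matrix.diagonal fun i => (a i : ℂ)) (Matrix.diagonal fun i => (b i : ℂ)) =
      Matrix.diagonal fun i => ((scalarGeomMean α (a i) (b i) : ℝ) : ℂ) := by
  have hsa : ∀ i, 0 < √(a i) := fun i => Real.sqrt_pos.2 (ha i)
  set S : Matrix (Fin n) (Fin n) ℂ := Matrix.diagonal fun i => ((√(a i) : ℝ) : ℂ) with hS
  have hSs : S.conjTranspose = S := by
    rw [hS, Matrix.diagonal_conjTranspose]
    congr 1
    funext i
    simp
  have hSu : IsUnit S := by
    rw [hS, Matrix.isUnit_diagonal, Pi.isUnit_iff]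
    intro i
    rw [isUnit_iff_ne_zero]
    exact_mod_cast (hsa i).ne'
  have key : ∀ e : Fin n → ℝ, S * Matrix.diagonal (fun i => (e i : ℂ)) * S.conjTranspose =
      Matrix.diagonal (fun i => ((a i * e i : ℝ) : ℂ)) := by
    intro e
    rw [hSs, hS, Matrix.diagonal_mul_diagonal, Matrix.diagonal_mul_diagonal]
    congr 1
    funext i
    rw [← Complex.ofReal_mul, ← Complex.ofReal_mul, mul_right_comm, Real.mul_self_sqrt (ha i).le]
  have hA : (Matrix.diagonal fun i => (a i : ℂ)) = S * S.conjTranspose := by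
    have := key fun _ => 1
    simp only [mul_one, Complex.ofReal_one, Matrix.diagonal_one] at this
    exact this.symm
  have hB : (Matrix.diagonal fun i => (b i : ℂ)) =
      S * Matrix.diagonal (fun i => ((b i / a i : ℝ) : ℂ)) * S.conjTranspose := by
    rw [key]
    congr 1
    funext i
    rw [mul_div_cancel₀ _ (ha i).ne']
  rw [hA, hB, posDefGeomMean_conj_diagonal α hSu fun i => (div_pos (hb i) (ha i)).le, key]
  congr 1
  funext i
  rw [scalarGeomMean, Real.div_rpow (hb i).le (ha i).le, Real.rpow_sub (ha i), Real.rpow_one]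
  congr 1
  ring

theorem continuous_scalarGeomMean {α : ℝ} (hα0 : 0 ≤ α) (hα1 : α ≤ 1) :
    Continuous fun p : ℝ × ℝ => scalarGeomMean α p.1 p.2 :=
  (continuous_fst.rpow_const fun _ => Or.inr (sub_nonneg.2 hα1)).mul
    (continuous_snd.rpow_const fun _ => Or.inr hα0)

theorem geomMean_diagonal {n : ℕ} {α : ℝ} (hα0 : 0 ≤ α) (hα1 : α ≤ 1) {a b : Fin n → ℝ}
    (ha : ∀ i, 0 ≤ a i) (hb : ∀ i, 0 ≤ b i) :
    geomMean α (Matrix.diagonal fun i => (a i : ℂ)) (Matrix.diagonal fun i => (b i : ℂ)) =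
      Matrix.diagonal fun i => ((scalarGeomMean α (a i) (b i) : ℝ) : ℂ) := by
  have hpsd : ∀ {c : Fin n → ℝ}, (∀ i, 0 ≤ c i) →
      (Matrix.diagonal fun i => (c i : ℂ)).PosSemidef := fun hc =>
    Matrix.PosSemidef.diagonal fun i => by simpa using hc i
  refine tendsto_nhds_unique (tendsto_geomMean hα0 hα1 (hpsd ha) (hpsd hb)) ?_
  have hadd : ∀ (c : Fin n → ℝ) (ε : ℝ), (Matrix.diagonal fun i => (c i : ℂ)) +
      ε • (1 : Matrix (Fin n) (Fin n) ℂ) = Matrix.diagonal fun i => ((c i + ε : ℝ) : ℂ) := by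
    intro c ε
    ext i j
    by_cases hij : i = j <;> simp [Matrix.diagonal, hij]
  have h1 : Continuous fun ε : ℝ =>
      (Matrix.diagonal fun i => ((scalarGeomMean α (a i + ε) (b i + ε) : ℝ) : ℂ)) := by
    refine Continuous.matrix_diagonal (continuous_pi fun i => Complex.continuous_ofReal.comp ?_)
    exact (continuous_scalarGeomMean hα0 hα1).comp
      (Continuous.prodMk (continuous_const.add continuous_id) (continuous_const.add continuous_id))
  have h2 := h1.tendsto 0
  simp only [add_zero] at h2
  refine (h2.mono_left nhdsWithin_le_nhds).congr' ?_
  filter_upwards [self_mem_nhdsWithin] with ε hε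
  have hε' : (0 : ℝ) < ε := hε
  rw [hadd, hadd, posDefGeomMean_diagonal α (fun i => add_pos_of_nonneg_of_pos (ha i) hε')
    (fun i => add_pos_of_nonneg_of_pos (hb i) hε')]

theorem scalarGeomMean_mono {α : ℝ} (hα0 : 0 ≤ α) (hα1 : α ≤ 1) {a a' b b' : ℝ} (ha : 0 ≤ a)
    (hb : 0 ≤ b) (haa' : a ≤ a') (hbb' : b ≤ b') :
    scalarGeomMean α a b ≤ scalarGeomMean α a' b' :=
  mul_le_mul (Real.rpow_le_rpow ha haa' (sub_nonneg.2 hα1)) (Real.rpow_le_rpow hb hbb' hα0)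
    (Real.rpow_nonneg hb _) (Real.rpow_nonneg (ha.trans haa') _)

theorem scalarGeomMean_mul {α : ℝ} {a a' b b' : ℝ} (ha : 0 ≤ a) (ha' : 0 ≤ a') (hb : 0 ≤ b)
    (hb' : 0 ≤ b') :
    scalarGeomMean α (a * a') (b * b') = scalarGeomMean α a b * scalarGeomMean α a' b' := by
  simp only [scalarGeomMean, Real.mul_rpow ha ha', Real.mul_rpow hb hb']
  ring

theorem scalarGeomMean_prod {ι : Type*} (α : ℝ) (s : Finset ι) {a b : ι → ℝ}
    (ha : ∀ i, 0 ≤ a i) (hb : ∀ i, 0 ≤ b i) :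
    scalarGeomMean α (∏ i ∈ s, a i) (∏ i ∈ s, b i) = ∏ i ∈ s, scalarGeomMean α (a i) (b i) := by
  simp only [scalarGeomMean, Finset.prod_mul_distrib]
  rw [Real.finsetProd_rpow _ _ fun i _ => ha i, Real.finsetProd_rpow _ _ fun i _ => hb i]

/-! ### Bounds for positive definite matrices -/

theorem topProd_nonneg {n : ℕ} (M : Matrix (Fin n) (Fin n) ℂ) (k : ℕ) : 0 ≤ topProd M k :=
  Finset.prod_nonneg fun _ _ => singVal_nonneg M _

theorem botProd_nonneg {n : ℕ} (M : Matrix (Fin n) (Fin n) ℂ) (k : ℕ) : 0 ≤ botProd M k :=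
  Finset.prod_nonneg fun _ _ => singVal_nonneg M _

theorem singVal_pos {n : ℕ} {M : Matrix (Fin n) (Fin n) ℂ} (hM : M.PosDef) {j : ℕ} (hj : j < n) :
    0 < singVal M j := by
  rw [singVal_eq_eigDec hM.posSemidef ⟨j, hj⟩]
  exact eigDec_pos hM _

theorem topProd_pos {n : ℕ} {M : Matrix (Fin n) (Fin n) ℂ} (hM : M.PosDef) {k : ℕ} (hk : k ≤ n) :
    0 < topProd M k :=
  Finset.prod_pos fun _ hj => singVal_pos hM ((Finset.mem_range.1 hj).trans_le hk)

theorem botProd_pos {n : ℕ} {M : Matrix (Fin n) (Fin n) ℂ} (hM : M.PosDef) (k : ℕ) :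
    0 < botProd M k :=
  Finset.prod_pos fun _ hj => singVal_pos hM (Finset.mem_Ico.1 hj).2

theorem topProd_mul_botProd {n : ℕ} (M : Matrix (Fin n) (Fin n) ℂ) {k : ℕ} (hk : k ≤ n) :
    topProd M k * botProd M (n - k) = topProd M n := by
  rw [topProd, botProd, Nat.sub_sub_self hk, topProd, Finset.prod_range_mul_prod_Ico _ hk]

theorem botProd_self {n : ℕ} (M : Matrix (Fin n) (Fin n) ℂ) : botProd M n = topProd M n := by
  rw [botProd, topProd, Nat.sub_self, Finset.range_eq_Ico]

/-- For k = n the maximum and the minimum of the compressed determinant coincide; evaluate at V = 1.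
-/
theorem topProd_self_eq_det {n : ℕ} {M : Matrix (Fin n) (Fin n) ℂ} (hM : M.PosSemidef) :
    topProd M n = M.det.re := by
  have h1 : compDet (1 : Matrix (Fin n) (Fin n) ℂ) M = M.det.re := by simp [compDet]
  have hV : (1 : Matrix (Fin n) (Fin n) ℂ).conjTranspose * 1 = 1 := by simp
  rw [← h1]
  refine le_antisymm ?_ (compDet_le_topProd hV hM)
  rw [← botProd_self]
  exact botProd_le_compDet le_rfl hV hM

/-- Hölder's inequality for the compressed determinants of a geometric mean. -/
theorem compDet_posDefGeomMean_le {n k : ℕ} {α : ℝ} (hα0 : 0 ≤ α) (hα1 : α ≤ 1)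
    {A B : Matrix (Fin n) (Fin n) ℂ} (hA : A.PosDef) (hB : B.PosDef)
    (V : Matrix (Fin n) (Fin k) ℂ) :
    compDet V (posDefGeomMean α A B) ≤ scalarGeomMean α (compDet V A) (compDet V B) := by
  obtain ⟨S, d, hS, hd, rfl, rfl⟩ := exists_congruence_diagonal hA hB
  rw [posDefGeomMean_conj_diagonal α hS fun i => (hd i).le, compDet_conj_diagonal,
    compDet_conj_diagonal, compDet_self_conj]
  -- The Hölder exponent is 1/α, so α = 0 is separate.
  rcases hα0.eq_or_lt with rfl | hα
  · simp [scalarGeomMean]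
  have hp : 1 ≤ α⁻¹ := (one_le_inv₀ hα).2 hα1
  have hprod : ∀ f : Fin k → Fin n, 0 ≤ ∏ j, d (f j) := fun f =>
    Finset.prod_nonneg fun j _ => (hd _).le
  -- Weighted Hölder: ∑ w g ≤ (∑ w)^{1-α} (∑ w g^{1/α})^α with g = (∏ d)^α; the two sums on the
  -- right are the compressions of A and B.
  have h := Real.inner_le_weight_mul_Lp_of_nonneg Finset.univ hp
    (minorWeight (V.conjTranspose * S)) (fun f => (∏ j, d (f j)) ^ α)
    (minorWeight_nonneg _) fun f => Real.rpow_nonneg (hprod f) α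
  simp only [inv_inv, Real.rpow_rpow_inv (hprod _) hα.ne'] at h
  rw [scalarGeomMean]
  convert! h using 4 with f
  exact Real.finsetProd_rpow _ _ (fun j _ => (hd _).le) α

theorem topProd_self_posDefGeomMean {n : ℕ} (α : ℝ) {A B : Matrix (Fin n) (Fin n) ℂ} (hA : A.PosDef)
    (hB : B.PosDef) :
    topProd (posDefGeomMean α A B) n = scalarGeomMean α (topProd A n) (topProd B n) := by
  rw [topProd_self_eq_det (posDefGeomMean_posDef α hA hB).posSemidef,
    topProd_self_eq_det hA.posSemidef, topProd_self_eq_det hB.posSemidef]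
  obtain ⟨S, d, hS, hd, rfl, rfl⟩ := exists_congruence_diagonal hA hB
  rw [posDefGeomMean_conj_diagonal α hS fun i => (hd i).le]
  have hdet : ∀ e : Fin n → ℝ,
      (S * Matrix.diagonal (fun i => (e i : ℂ)) * S.conjTranspose).det.re =
        ‖S.det‖ ^ 2 * ∏ i, e i := by
    intro e
    rw [Matrix.det_mul, Matrix.det_mul, Matrix.det_diagonal, Matrix.det_conjTranspose,
      mul_right_comm, Complex.star_def, Complex.mul_conj', ← Complex.ofReal_prod]
    exact_mod_cast Complex.ofReal_re _
  have h1 := hdet fun _ => 1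
  simp only [Complex.ofReal_one, Matrix.diagonal_one, Finset.prod_const_one,
    mul_one] at h1
  have hs : 0 < ‖S.det‖ ^ 2 := by
    have := (Matrix.isUnit_iff_isUnit_det S).1 hS
    have := norm_pos_iff.2 this.ne_zero
    positivity
  have hdp : 0 ≤ ∏ i, d i := Finset.prod_nonneg fun i _ => (hd i).le
  rw [hdet, hdet, h1, scalarGeomMean, Real.mul_rpow hs.le hdp, ← mul_assoc,
    ← Real.rpow_add hs, sub_add_cancel, Real.rpow_one,
    Real.finsetProd_rpow _ _ fun i _ => (hd i).le]

theorem compDet_nonneg {n k : ℕ} (V : Matrix (Fin n) (Fin k) ℂ) {M : Matrix (Fin n) (Fin n) ℂ}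
    (hM : M.PosSemidef) : 0 ≤ compDet V M :=
  (Complex.le_def.1 (hM.conjTranspose_mul_mul_same V).det_nonneg).1

section PosDefBounds

variable {n k : ℕ} {α : ℝ} {A B : Matrix (Fin n) (Fin n) ℂ}

theorem topProd_posDefGeomMean_le (hα0 : 0 ≤ α) (hα1 : α ≤ 1) (hA : A.PosDef) (hB : B.PosDef)
    (hk : k ≤ n) :
    topProd (posDefGeomMean α A B) k ≤ scalarGeomMean α (topProd A k) (topProd B k) := by
  obtain ⟨V, hV, h⟩ :=
    exists_isometry_compDet_eq_topProd hk (posDefGeomMean_posDef α hA hB).posSemidef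
  rw [← h]
  exact (compDet_posDefGeomMean_le hα0 hα1 hA hB V).trans
    (scalarGeomMean_mono hα0 hα1 (compDet_nonneg V hA.posSemidef) (compDet_nonneg V hB.posSemidef)
      (compDet_le_topProd hV hA.posSemidef) (compDet_le_topProd hV hB.posSemidef))

theorem botProd_posDefGeomMean_le (hα0 : 0 ≤ α) (hα1 : α ≤ 1) (hA : A.PosDef) (hB : B.PosDef)
    (hk : k ≤ n) :
    botProd (posDefGeomMean α A B) k ≤ scalarGeomMean α (botProd A k) (topProd B k) := by
  -- V is chosen extremal for A rather than for the mean, so that the bottom product of A appears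
  -- exactly.
  obtain ⟨V, hV, h⟩ := exists_isometry_compDet_eq_botProd hk hA.posSemidef
  rw [← h]
  exact ((botProd_le_compDet hk hV (posDefGeomMean_posDef α hA hB).posSemidef).trans
    (compDet_posDefGeomMean_le hα0 hα1 hA hB V)).trans
    (scalarGeomMean_mono hα0 hα1 (compDet_nonneg V hA.posSemidef) (compDet_nonneg V hB.posSemidef)
      le_rfl (compDet_le_topProd hV hB.posSemidef))

theorem scalarGeomMean_pos {a b : ℝ} (ha : 0 < a) (hb : 0 < b) : 0 < scalarGeomMean α a b :=
  mul_pos (Real.rpow_pos_of_pos ha _) (Real.rpow_pos_of_pos hb _)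

theorem le_topProd_posDefGeomMean (hα0 : 0 ≤ α) (hα1 : α ≤ 1) (hA : A.PosDef) (hB : B.PosDef)
    (hk : k ≤ n) :
    scalarGeomMean α (topProd A k) (botProd B k) ≤ topProd (posDefGeomMean α A B) k := by
  -- The upper bound for the n - k smallest singular values of the mean; dividing the determinant
  -- identity by it bounds the k largest from below.
  have h1 := botProd_posDefGeomMean_le hα0 hα1 hA hB (Nat.sub_le n k)
  have h2 := topProd_self_posDefGeomMean α hA hB
  have hB' := topProd_mul_botProd B (Nat.sub_le n k)
  rw [Nat.sub_sub_self hk, mul_comm] at hB'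
  rw [← topProd_mul_botProd _ hk, ← topProd_mul_botProd A hk, ← hB',
    scalarGeomMean_mul (topProd_nonneg _ _) (botProd_nonneg _ _) (botProd_nonneg _ _)
      (topProd_nonneg _ _)] at h2
  have hq := scalarGeomMean_pos (α := α) (botProd_pos hA (n - k)) (topProd_pos hB (Nat.sub_le n k))
  refine le_of_mul_le_mul_right ?_ hq
  rw [← h2]
  exact mul_le_mul_of_nonneg_left h1 (topProd_nonneg _ _)

theorem le_botProd_posDefGeomMean (hα0 : 0 ≤ α) (hα1 : α ≤ 1) (hA : A.PosDef) (hB : B.PosDef)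
    (hk : k ≤ n) :
    scalarGeomMean α (botProd A k) (botProd B k) ≤ botProd (posDefGeomMean α A B) k := by
  have h1 := topProd_posDefGeomMean_le hα0 hα1 hA hB (Nat.sub_le n k)
  have h2 := topProd_self_posDefGeomMean α hA hB
  have hX : ∀ X : Matrix (Fin n) (Fin n) ℂ, topProd X n = topProd X (n - k) * botProd X k := by
    intro X
    rw [← topProd_mul_botProd X (Nat.sub_le n k), Nat.sub_sub_self hk]
  rw [hX, hX A, hX B, scalarGeomMean_mul (topProd_nonneg _ _) (botProd_nonneg _ _)
    (topProd_nonneg _ _) (botProd_nonneg _ _)] at h2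
  have hq := scalarGeomMean_pos (α := α) (topProd_pos hA (Nat.sub_le n k))
    (topProd_pos hB (Nat.sub_le n k))
  refine le_of_mul_le_mul_left ?_ hq
  rw [← h2]
  exact mul_le_mul_of_nonneg_right h1 (botProd_nonneg _ _)

end PosDefBounds

/-! ### Passage to positive semidefinite matrices -/

section PosSemidefBounds

variable {n k : ℕ} {α : ℝ} {A B : Matrix (Fin n) (Fin n) ℂ}

theorem tendsto_topProd (hk : k ≤ n) {G : ℝ → Matrix (Fin n) (Fin n) ℂ}
    {L : Matrix (Fin n) (Fin n) ℂ} (hG : ∀ ε, 0 < ε → (G ε).PosSemidef) (hL : L.PosSemidef)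
    (h : Tendsto G (𝓝[>] 0) (𝓝 L)) :
    Tendsto (fun ε => topProd (G ε) k) (𝓝[>] 0) (𝓝 (topProd L k)) :=
  (continuousOn_topProd hk L hL).tendsto.comp (tendsto_nhdsWithin_iff.2 ⟨h, by
    filter_upwards [self_mem_nhdsWithin] with ε hε using hG ε hε⟩)

theorem tendsto_botProd (hk : k ≤ n) {G : ℝ → Matrix (Fin n) (Fin n) ℂ}
    {L : Matrix (Fin n) (Fin n) ℂ} (hG : ∀ ε, 0 < ε → (G ε).PosSemidef) (hL : L.PosSemidef)
    (h : Tendsto G (𝓝[>] 0) (𝓝 L)) :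
    Tendsto (fun ε => botProd (G ε) k) (𝓝[>] 0) (𝓝 (botProd L k)) :=
  (continuousOn_botProd hk L hL).tendsto.comp (tendsto_nhdsWithin_iff.2 ⟨h, by
    filter_upwards [self_mem_nhdsWithin] with ε hε using hG ε hε⟩)

theorem geomMean_bounds (hα0 : 0 ≤ α) (hα1 : α ≤ 1) (hA : A.PosSemidef) (hB : B.PosSemidef)
    (hk : k ≤ n) :
    (scalarGeomMean α (topProd A k) (botProd B k) ≤ topProd (geomMean α A B) k ∧
      topProd (geomMean α A B) k ≤ scalarGeomMean α (topProd A k) (topProd B k)) ∧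
    (botProd (geomMean α A B) k ≤ scalarGeomMean α (botProd A k) (topProd B k) ∧
      scalarGeomMean α (botProd A k) (botProd B k) ≤ botProd (geomMean α A B) k) := by
  have hGt := tendsto_geomMean hα0 hα1 hA hB
  have hGp := posSemidef_geomMean hα0 hα1 hA hB
  have hGε : ∀ ε : ℝ, 0 < ε → (posDefGeomMean α (A + ε • 1) (B + ε • 1)).PosSemidef := fun ε hε =>
    (posDefGeomMean_posDef α (posDef_add_smul_one hA hε) (posDef_add_smul_one hB hε)).posSemidef
  have hAε : ∀ ε : ℝ, 0 < ε → (A + ε • (1 : Matrix (Fin n) (Fin n) ℂ)).PosSemidef := fun ε hε =>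
    (posDef_add_smul_one hA hε).posSemidef
  have hBε : ∀ ε : ℝ, 0 < ε → (B + ε • (1 : Matrix (Fin n) (Fin n) ℂ)).PosSemidef := fun ε hε =>
    (posDef_add_smul_one hB hε).posSemidef
  have tG := tendsto_topProd hk hGε hGp hGt
  have bG := tendsto_botProd hk hGε hGp hGt
  have tA := tendsto_topProd hk hAε hA (tendsto_add_smul_one A)
  have bA := tendsto_botProd hk hAε hA (tendsto_add_smul_one A)
  have tB := tendsto_topProd hk hBε hB (tendsto_add_smul_one B)
  have bB := tendsto_botProd hk hBε hB (tendsto_add_smul_one B)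
  have hs : ∀ {u v : ℝ → ℝ} {a b : ℝ}, Tendsto u (𝓝[>] 0) (𝓝 a) → Tendsto v (𝓝[>] 0) (𝓝 b) →
      Tendsto (fun ε => scalarGeomMean α (u ε) (v ε)) (𝓝[>] 0) (𝓝 (scalarGeomMean α a b)) :=
    fun hu hv => ((continuous_scalarGeomMean hα0 hα1).tendsto _).comp (hu.prodMk_nhds hv)
  refine ⟨⟨le_of_tendsto_of_tendsto (hs tA bB) tG ?_, le_of_tendsto_of_tendsto tG (hs tA tB) ?_⟩,
    le_of_tendsto_of_tendsto bG (hs bA tB) ?_, le_of_tendsto_of_tendsto (hs bA bB) bG ?_⟩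
  all_goals filter_upwards [self_mem_nhdsWithin] with ε hε
  · exact le_topProd_posDefGeomMean hα0 hα1 (posDef_add_smul_one hA hε)
      (posDef_add_smul_one hB hε) hk
  · exact topProd_posDefGeomMean_le hα0 hα1 (posDef_add_smul_one hA hε)
      (posDef_add_smul_one hB hε) hk
  · exact botProd_posDefGeomMean_le hα0 hα1 (posDef_add_smul_one hA hε)
      (posDef_add_smul_one hB hε) hk
  · exact le_botProd_posDefGeomMean hα0 hα1 (posDef_add_smul_one hA hε)
      (posDef_add_smul_one hB hε) hk

end PosSemidefBounds

/-! ### Log-majorization -/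

theorem prod_eigDec_eq_topProd {n k : ℕ} (hk : k ≤ n) {M : Matrix (Fin n) (Fin n) ℂ}
    (hM : M.PosSemidef) :
    ∏ i : Fin n with i.val < k, eigDec hM.isHermitian i = topProd M k := by
  have h1 : ∏ i : Fin n with i.val < k, eigDec hM.isHermitian i =
      ∏ i : Fin n with i.val < k, singVal M i :=
    Finset.prod_congr rfl fun i _ => (singVal_eq_eigDec hM i).symm
  rw [h1, topProd, ← Finset.prod_image (g := fun i : Fin n => (i : ℕ)) (f := singVal M)
    Fin.val_injective.injOn]
  congr 1
  ext j
  simp only [Finset.mem_image, Finset.mem_filter, Finset.mem_univ, true_and, Finset.mem_range]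
  exact ⟨by rintro ⟨i, hi, rfl⟩; exact hi, fun hj => ⟨⟨j, hj.trans_le hk⟩, hj, rfl⟩⟩

theorem topProd_diagonal {n k : ℕ} (hk : k ≤ n) {d : ℕ → ℝ} (hd : Antitone d)
    (hd0 : ∀ i, 0 ≤ d i) :
    topProd (Matrix.diagonal fun i : Fin n => (d i : ℂ)) k = ∏ j ∈ Finset.range k, d j := by
  refine Finset.prod_congr rfl fun j hj => ?_
  have hj' : j < n := (Finset.mem_range.1 hj).trans_le hk
  have := singVal_eq_of_unitary_conj (U := (1 : Matrix (Fin n) (Fin n) ℂ)) (by simp)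
    (d := fun i : Fin n => d i) (fun a b hab => hd hab) (fun i => hd0 i) ⟨j, hj'⟩
  simpa using this

/-- The mean of the ordered diagonals is entrywise and again decreasing, and the scalar mean is
multiplicative; so the upper bound is attained here. -/
theorem topProd_geomMean_diagDec {n k : ℕ} {α : ℝ} (hα0 : 0 ≤ α) (hα1 : α ≤ 1)
    {A B : Matrix (Fin n) (Fin n) ℂ} (hA : A.PosSemidef) (hB : B.PosSemidef) (hk : k ≤ n) :
    topProd (geomMean α (diagDec hA.isHermitian) (diagDec hB.isHermitian)) k =
      scalarGeomMean α (topProd A k) (topProd B k) := by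
  have h : geomMean α (diagDec hA.isHermitian) (diagDec hB.isHermitian) =
      Matrix.diagonal fun i : Fin n => ((scalarGeomMean α (singVal A i) (singVal B i) : ℝ) : ℂ) := by
    rw [diagDec, diagDec, geomMean_diagonal hα0 hα1 (eigDec_nonneg hA) (eigDec_nonneg hB)]
    simp only [singVal_eq_eigDec hA, singVal_eq_eigDec hB]
  rw [h, topProd_diagonal hk (d := fun j => scalarGeomMean α (singVal A j) (singVal B j))
    (fun i j hij => scalarGeomMean_mono hα0 hα1 (singVal_nonneg A j) (singVal_nonneg B j)
      (singVal_antitone A hij) (singVal_antitone B hij))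
    (fun j => mul_nonneg (Real.rpow_nonneg (singVal_nonneg A j) _)
      (Real.rpow_nonneg (singVal_nonneg B j) _))]
  exact (scalarGeomMean_prod α _ (singVal_nonneg A) (singVal_nonneg B)).symm

theorem posSemidef_diagDec {n : ℕ} {M : Matrix (Fin n) (Fin n) ℂ} (hM : M.PosSemidef) :
    (diagDec hM.isHermitian).PosSemidef :=
  Matrix.PosSemidef.diagonal fun i => by simpa using eigDec_nonneg hM i

theorem proposition3p5 {n : ℕ} (α : ℝ) (hα0 : 0 ≤ α) (hα1 : α ≤ 1)
    (A B : Matrix (Fin n) (Fin n) ℂ) (hA : A.PosSemidef) (hB : B.PosSemidef) :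
    -- the limit that defines the mean exists, and agrees with the formula for invertible matrices
    Tendsto (fun ε : ℝ => posDefGeomMean α (A + ε • 1) (B + ε • 1)) (𝓝[>] 0)
      (𝓝 (geomMean α A B)) ∧
    -- the two-sided bounds
    (∀ k : ℕ, 1 ≤ k → k ≤ n →
      (scalarGeomMean α (topProd A k) (botProd B k) ≤ topProd (geomMean α A B) k ∧
        topProd (geomMean α A B) k ≤ scalarGeomMean α (topProd A k) (topProd B k)) ∧
      (botProd (geomMean α A B) k ≤ scalarGeomMean α (botProd A k) (topProd B k) ∧
        scalarGeomMean α (botProd A k) (botProd B k) ≤ botProd (geomMean α A B) k)) ∧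
    -- the log-majorization
    LogMajorized (geomMean α A B)
      (geomMean α (diagDec hA.isHermitian) (diagDec hB.isHermitian)) := by
  have hX := posSemidef_geomMean hα0 hα1 hA hB
  have hY := posSemidef_geomMean hα0 hα1 (posSemidef_diagDec hA) (posSemidef_diagDec hB)
  refine ⟨tendsto_geomMean hα0 hα1 hA hB, fun k _ hk => geomMean_bounds hα0 hα1 hA hB hk,
    hX, hY, fun k _ hk => ?_, ?_⟩
  · rw [prod_eigDec_eq_topProd hk hX, prod_eigDec_eq_topProd hk hY,
      topProd_geomMean_diagDec hα0 hα1 hA hB hk]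
    exact (geomMean_bounds hα0 hα1 hA hB hk).1.2
  · have hall : ∀ {M : Matrix (Fin n) (Fin n) ℂ} (hM : M.PosSemidef),
        ∏ i : Fin n, eigDec hM.isHermitian i = topProd M n := by
      intro M hM
      rw [← prod_eigDec_eq_topProd le_rfl hM]
      simp
    rw [hall hX, hall hY, topProd_geomMean_diagDec hα0 hα1 hA hB le_rfl]
    have h := (geomMean_bounds hα0 hα1 hA hB (le_refl n)).1
    -- At k = n the bottom product of B is its top product, so the two bounds force equality, also
    -- for singular matrices.
    exact le_antisymm h.2 (by simpa only [botProd_self] using h.1)
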